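/- Let $I$ be a nonempty finite set of players; let each player $i\in I$ have a nonempty finite action set $A_i$ and a payoff function $u_i:A=\prod_{j\in I}A_j\to\mathbb{R}$; write $A_{-i}=\prod_{j\neq i}A_j$. Let $\Delta_i$ be the set of probability distributions on $A_i$, and for $\pi\in\prod_i\Delta_i$ let $U_i(\pi)=\sum_{a\in A}\bigl(\prod_{j}\pi_j(a_j)\bigr)u_i(a)$. For $\epsilon>0$, $\pi$ is an $\epsilon$-Nash equilibrium if $U_i(\pi_i,\pi_{-i})\ge U_i(\pi_i',\pi_{-i})-\epsilon$ for all $i\in I$ and $\pi_i'\in\Delta_i$. For an integer $M\ge 1$ let $\Delta_j^M$ be the set of $p\in\Delta_j$ with all $p(a_j)\in\{0,\tfrac1M,\dots,\tfrac MM\}$, and let $\mathcal{B}_i=\prod_{j\neq i}\Delta_j^M$ be the set of beliefs $b_i=(b_{ij})_{j\ne i}$ of player $i$. For $\sigma>0$ the smooth best response of player $i$ to $b_i$ is $$\mathrm{Br}_i^\sigma(a_i\mid b_i)=\frac{e^{U_i(a_i,b_i)/\sigma}}{\sum_{a_i'\in A_i}e^{U_i(a_i',b_i)/\sigma}},\qquad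 U_i(a_i,b_i)=\sum_{a_{-i}\in A_{-i}}u_i(a_i,a_{-i})\prod_{j\neq i}b_{ij}(a_j).$$ For $\tau>0$ a consistent state is a pair $(b,\pi)$ such that, for every $i\in I$, $b_i\in\mathcal{B}_i$, $\pi_i=\mathrm{Br}_i^\sigma(b_i)$ and $\|b_i-\pi_{-i}\|_2=\bigl(\sum_{j\neq i}\sum_{a_j\in A_j}(b_{ij}(a_j)-\pi_j(a_j))^2\bigr)^{1/2}\le\tau$. Put $m=\max_{i}|A_i|$, $N=\max_i|A_i|\,|A_{-i}|$ and $\bar u=\max_{i\in I,\,a\in A}|u_i(a)|$. Let $\epsilon,\sigma,\tau>0$ and let $M\ge1$ be an integer such that $$\sigma\le\frac{\epsilon}{2\log m},\qquad \tau\le\frac{\epsilon\,\sigma}{2\sqrt{|A|}\;\bar u^{2}\,N},\qquad M\ge\frac{|I|\,m}{\tau}\left(1+\frac{\sqrt{m}}{\sigma}\,\bar u\,N\,|I|\right),$$ where a bound with denominator $0$ imposes no restriction. Then the set of consistent states is nonempty, and for every consistent state $(b,\pi)$ the profile $\pi$ is an $\epsilon$-Nash equilibrium. -/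

import Mathlib

open Finset

namespace SmoothBR

noncomputable section

/-- The set `Δ_i^M` of probability vectors on a finite set all of whose entries lie in
`{0, 1/M, …, M/M}`. -/
def gridSimplex (M : ℕ) (α : Type*) [Fintype α] : Set (α → ℝ) :=
  {p | p ∈ stdSimplex ℝ α ∧ ∀ a, ∃ m : ℕ, m ≤ M ∧ p a = (m : ℝ) / (M : ℝ)}

/-- A vector `b_i = (b_{ij})_{j ≠ i}` with `b_{ij} ∈ ℝ^{A_j}`: the ambient space for beliefs of
player `i` about the opponents, and for opponents' strategy profiles `π_{-i}`. -/
abbrev OppVec {I : Type*} (A : I → Type*) (i : I) : Type _ :=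
  (j : {j : I // j ≠ i}) → A j → ℝ

variable {I : Type*} [Fintype I] [DecidableEq I] {A : I → Type*} [∀ i, Fintype (A i)]

/-- The discretized belief space `B_i = ∏_{j ≠ i} Δ_j^M`. -/
def beliefSpace (M : ℕ) (A : I → Type*) [∀ i, Fintype (A i)] (i : I) : Set (OppVec A i) :=
  {b | ∀ j : {j : I // j ≠ i}, b j ∈ gridSimplex M (A j)}

/-- The opponents' part `π_{-i}` of a profile `π`. -/
def opp (π : (i : I) → A i → ℝ) (i : I) : OppVec A i := fun j => π j

/-- Expected utility `U_i(π) = E_{a ∼ π} [u_i(a)]`, players randomizing independently. -/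
def utility (u : I → ((i : I) → A i) → ℝ) (i : I) (π : (i : I) → A i → ℝ) : ℝ :=
  ∑ a : (j : I) → A j, (∏ j, π j (a j)) * u i a

/-- Anticipated utility `U_i(a_i, b_i) = ∑_{a_{-i}} u_i(a_i, a_{-i}) b_i(a_{-i})`, where
`b_i(a_{-i}) = ∏_{j ≠ i} b_{ij}(a_j)`. -/
def beliefUtility (u : I → ((i : I) → A i) → ℝ) (i : I) (ai : A i) (b : OppVec A i) : ℝ :=
  ∑ a : (j : {j : I // j ≠ i}) → A j,
    u i ((Equiv.piSplitAt i A).symm (ai, a)) * ∏ j, b j (a j)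

/-- The smooth (logit) best response of player `i` at temperature `σ` to the belief `b`. -/
def smoothBR (u : I → ((i : I) → A i) → ℝ) (σ : ℝ) (i : I) (b : OppVec A i) : A i → ℝ :=
  fun ai => Real.exp ((1 / σ) * beliefUtility u i ai b) /
    ∑ ai' : A i, Real.exp ((1 / σ) * beliefUtility u i ai' b)

/-- The Euclidean distance `‖b - c‖₂` in `∏_{j ≠ i} ℝ^{A_j}`. -/
def oppDist (i : I) (b c : OppVec A i) : ℝ :=
  √(∑ j : {j : I // j ≠ i}, ∑ aj : A j, (b j aj - c j aj) ^ 2)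

/-- The state space `Z`: pairs `(b, π)` of discretized beliefs and the smooth best responses
to them. -/
def states (u : I → ((i : I) → A i) → ℝ) (σ : ℝ) (M : ℕ) :
    Set (((i : I) → OppVec A i) × ((i : I) → A i → ℝ)) :=
  {z | ∀ i, z.1 i ∈ beliefSpace M A i ∧ z.2 i = smoothBR u σ i (z.1 i)}

/-- The consistent states: every belief is within `τ` of the opponents' actual strategies. -/
def consistentStates (u : I → ((i : I) → A i) → ℝ) (σ τ : ℝ) (M : ℕ) :
    Set (((i : I) → OppVec A i) × ((i : I) → A i → ℝ)) :=
  {z | z ∈ states u σ M ∧ ∀ i, oppDist i (z.1 i) (opp z.2 i) ≤ τ}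

/-- `π` is a mixed strategy profile and an `ε`-Nash equilibrium. -/
def IsEpsNash (u : I → ((i : I) → A i) → ℝ) (ε : ℝ) (π : (i : I) → A i → ℝ) : Prop :=
  (∀ i, π i ∈ stdSimplex ℝ (A i)) ∧
    ∀ i, ∀ π' ∈ stdSimplex ℝ (A i),
      utility u i π ≥ utility u i (Function.update π i π') - ε

/-- `max_i |A_i|`. -/
def maxActions (A : I → Type*) [∀ i, Fintype (A i)] [Nonempty I] : ℕ :=
  univ.sup' univ_nonempty fun i : I => Fintype.card (A i)

/-- `max_i |A_i| |A_{-i}|`. -/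
def maxProd (A : I → Type*) [∀ i, Fintype (A i)] [Nonempty I] : ℕ :=
  univ.sup' univ_nonempty fun i : I =>
    Fintype.card (A i) * Fintype.card ((j : {j : I // j ≠ i}) → A j)

/-- `max_{i, a} |u_i(a)|`. -/
def maxPayoff [Nonempty I] [∀ i, Nonempty (A i)] (u : I → ((i : I) → A i) → ℝ) : ℝ :=
  univ.sup' univ_nonempty fun p : I × ((i : I) → A i) => |u p.1 p.2|

/-- The condition on `σ`, `τ`, `M` for a given `ε`. The first two bounds are cleared of
denominators, which vanish if all `|A_i| = 1`, respectively if `u = 0`; the bound then holds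
trivially. -/
structure ParamCond [Nonempty I] [∀ i, Nonempty (A i)] (u : I → ((i : I) → A i) → ℝ)
    (ε σ τ : ℝ) (M : ℕ) : Prop where
  sigma_le : σ * (2 * Real.log (maxActions A)) ≤ ε
  tau_le : τ * (2 * √(Fintype.card ((i : I) → A i)) * maxPayoff u ^ 2 * maxProd A) ≤ ε * σ
  le_M : (Fintype.card I * maxActions A) / τ *
      (1 + √(maxActions A) / σ * maxPayoff u * maxProd A * Fintype.card I) ≤ (M : ℝ)

end

end SmoothBR

/-! Existence comes from a logit equilibrium, a profile `π` with every `π i` the smooth best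
response to `π` itself. `exists_logit_equilibrium` obtains it from Brouwer's theorem for bounded
`C^1` maps, proved here by a volume argument: a retraction `f` of the ball onto the sphere would
make `∫ det (1 + t (f' - 1))`, a polynomial in `t`, equal to the volume of the ball for small `t >
0` and to zero at `t = 1`. The equilibrium is then rounded to a grid profile `q`, within `1/M` in
each coordinate. Multilinearity of the payoffs and the Lipschitz bound for softmax keep the
responses to `q` near `π`, hence near `q`; the lower bound on `M` turns this into distance at most
`τ`. For the Nash property, a logit response loses at most `σ log |A_i|` against its own belief (an
entropy bound), and using the belief in place of the truth costs at most twice `maxPayoff u` times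
their `ℓ¹` distance (`utility_update_le`). The conditions on `σ` and `τ` make each loss at most
`ε/2`. -/

namespace SmoothBR

/-! ### Brouwer's fixed point theorem for bounded `C^1` maps. -/

section Brouwer

open Metric MeasureTheory Polynomial

theorem exists_polynomial_det {n : Type*} [Fintype n] [DecidableEq n] (B : Matrix n n ℝ) :
    ∃ p : ℝ[X], p.natDegree ≤ Fintype.card n ∧ ∀ t : ℝ, p.eval t = (1 + t • B).det := by
  refine ⟨_, Polynomial.natDegree_det_X_add_C_le B 1, fun t => ?_⟩
  rw [← Polynomial.coe_evalRingHom, RingHom.map_det]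
  congr 1
  ext i j
  by_cases hij : i = j <;> simp [hij, add_comm, mul_comm t]

variable {E : Type*} [NormedAddCommGroup E] [InnerProductSpace ℝ E]

theorem sum_eval_basis_one (s : Fin (Module.finrank ℝ E + 1) → ℝ) (hs : Function.Injective s) :
    ∑ k, (Lagrange.basis univ s k).eval 1 = 1 := by
  rw [← Polynomial.eval_finsetSum, Lagrange.sum_basis hs.injOn ⟨0, mem_univ _⟩, eval_one]

theorem exists_det_one_add_pos : ∃ δ > 0, ∀ T : E →L[ℝ] E, ‖T‖ < δ → 0 < (1 + T).det := by
  have hc : Continuous fun T : E →L[ℝ] E => (1 + T).det :=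
    ContinuousLinearMap.continuous_det.comp (continuous_const.add continuous_id)
  have h0 : 0 < (1 + (0 : E →L[ℝ] E)).det := by
    rw [add_zero, ContinuousLinearMap.det]
    exact (LinearMap.det_id (M := E) (A := ℝ)).symm ▸ one_pos
  have := (isOpen_lt continuous_const hc).mem_nhds h0
  obtain ⟨δ, hδ, h⟩ := Metric.mem_nhds_iff.1 this
  exact ⟨δ, hδ, fun T hT => h (by simpa using hT)⟩

variable [FiniteDimensional ℝ E]

theorem surjective_of_det_ne_zero {T : E →L[ℝ] E} (hT : T.det ≠ 0) : Function.Surjective T := by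
  have hu : IsUnit (LinearMap.det (T : E →ₗ[ℝ] E)) := isUnit_iff_ne_zero.2 hT
  have := (Module.End.isUnit_iff _).1 ((LinearMap.isUnit_iff_isUnit_det _).2 hu)
  exact this.2

/-- A polynomial in `t` of degree at most the dimension is determined by its values at `finrank + 1`
nodes. The weights do not depend on `T`, so the identity can be integrated over a family of
operators. -/
theorem det_one_add_eq_sum (s : Fin (Module.finrank ℝ E + 1) → ℝ) (hs : Function.Injective s)
    (T : E →L[ℝ] E) :
    (1 + T).det = ∑ k, (Lagrange.basis univ s k).eval 1 * (1 + s k • T).det := by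
  classical
  have key : ∀ t : ℝ, (1 + t • T).det =
      (1 + t • LinearMap.toMatrix (Module.finBasis ℝ E) (Module.finBasis ℝ E) (T : E →ₗ[ℝ] E)).det := by
    intro t
    rw [ContinuousLinearMap.det, ← LinearMap.det_toMatrix (Module.finBasis ℝ E)]
    congr 1
    rw [ContinuousLinearMap.toLinearMap_add, ContinuousLinearMap.toLinearMap_smul, map_add, map_smul]
    congr 1
    exact LinearMap.toMatrix_id _
  obtain ⟨p, hp, hpe⟩ := exists_polynomial_det
    (LinearMap.toMatrix (Module.finBasis ℝ E) (Module.finBasis ℝ E) (T : E →ₗ[ℝ] E))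
  have h1 : (1 + T).det = p.eval 1 := by rw [hpe, ← key, one_smul]
  have hd : p.degree < #(univ : Finset (Fin (Module.finrank ℝ E + 1))) := by
    refine lt_of_le_of_lt Polynomial.degree_le_natDegree ?_
    simp at hp ⊢
    exact_mod_cast Nat.lt_succ_of_le hp
  rw [h1, Lagrange.eq_interpolate (hs.injOn) hd, Lagrange.interpolate_apply,
    Polynomial.eval_finsetSum]
  refine sum_congr rfl fun k _ => ?_
  rw [Polynomial.eval_mul, Polynomial.eval_C, hpe, ← key, mul_comm]

/-- Perturbations of the identity that fix the unit sphere map the ball onto itself. -/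
theorem image_closedBall_eq {h : E → E} (hd : ∀ x ∈ closedBall (0 : E) 1, ContDiffAt ℝ 1 h x)
    (hdet : ∀ x ∈ closedBall (0 : E) 1, (fderiv ℝ h x).det ≠ 0)
    (hid : ∀ x ∈ sphere (0 : E) 1, h x = x)
    (hball : ∀ x ∈ ball (0 : E) 1, h x ∈ ball (0 : E) 1) :
    h '' closedBall 0 1 = closedBall 0 1 := by
  have hcont : ContinuousOn h (closedBall 0 1) := fun x hx =>
    (hd x hx).continuousAt.continuousWithinAt
  have hcl : IsClosed (h '' closedBall 0 1) :=
    ((isCompact_closedBall _ _).image_of_continuousOn hcont).isClosed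
  have hopen : IsOpen (h '' ball 0 1) := by
    rw [isOpen_iff_mem_nhds]
    rintro _ ⟨x, hx, rfl⟩
    have hx' := ball_subset_closedBall hx
    have hs := (hd x hx').hasStrictFDerivAt one_ne_zero
    have hsurj : (fderiv ℝ h x).range = ⊤ := by
      exact LinearMap.range_eq_top.2 (surjective_of_det_ne_zero (hdet x hx'))
    rw [← hs.map_nhds_eq_of_surj hsurj]
    exact Filter.image_mem_map (isOpen_ball.mem_nhds hx)
  have hsub : h '' ball 0 1 ⊆ ball 0 1 := by rintro _ ⟨x, hx, rfl⟩; exact hball x hx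
  have heq : ball (0 : E) 1 ⊆ h '' ball 0 1 := by
    have hpc : IsPreconnected (ball (0 : E) 1) := (convex_ball _ _).isPreconnected
    -- The image of the open ball is open by the inverse function theorem, and the image of the
    -- closed ball is closed. Since sphere points are fixed, the first image and the complement of
    -- the second cover the connected open ball.
    refine hpc.subset_left_of_subset_union hopen hcl.isOpen_compl ?_ ?_ ?_
    · exact Set.disjoint_compl_right_iff_subset.2 (Set.image_mono ball_subset_closedBall)
    · intro y hy
      by_cases hyy : y ∈ h '' closedBall 0 1
      · obtain ⟨x, hx, rfl⟩ := hyy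
        left
        refine ⟨x, ?_, rfl⟩
        by_contra hxb
        have hxs : x ∈ sphere (0 : E) 1 := by
          rw [← closedBall_sdiff_ball]; exact ⟨hx, hxb⟩
        rw [hid x hxs] at hy
        exact hxb hy
      · exact Or.inr hyy
    · exact ⟨h 0, hball 0 (by simp), 0, by simp, rfl⟩
  apply Set.Subset.antisymm
  · rintro _ ⟨x, hx, rfl⟩
    by_cases hxb : x ∈ ball (0 : E) 1
    · exact ball_subset_closedBall (hball x hxb)
    · rw [hid x (by rw [← closedBall_sdiff_ball]; exact ⟨hx, hxb⟩)]; exact hx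
  · intro y hy
    by_cases hyb : y ∈ ball (0 : E) 1
    · exact Set.image_mono ball_subset_closedBall (heq hyb)
    · exact ⟨y, hy, hid y (by rw [← closedBall_sdiff_ball]; exact ⟨hy, hyb⟩)⟩

variable [MeasurableSpace E] [BorelSpace E]

/-- There is no `C^1` retraction of the unit ball onto the unit sphere. -/
theorem no_retraction {f : E → E} (hd : ∀ x ∈ closedBall (0 : E) 1, ContDiffAt ℝ 1 f x)
    (hid : ∀ x ∈ sphere (0 : E) 1, f x = x) (hf : ∀ x ∈ closedBall (0 : E) 1, ‖f x‖ = 1) :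
    False := by
  have hfd : ContinuousOn (fderiv ℝ f) (closedBall 0 1) := fun x hx =>
    ((hd x hx).fderiv_right (m := 0) (by norm_num)).continuousAt.continuousWithinAt
  set G : E → E →L[ℝ] E := fun x => fderiv ℝ f x - 1 with hG
  have hGc : ContinuousOn G (closedBall 0 1) := hfd.sub continuousOn_const
  obtain ⟨K, hK⟩ := (isCompact_closedBall (0 : E) 1).exists_bound_of_continuousOn hGc
  have hK0 : 0 ≤ K := (norm_nonneg _).trans (hK 0 (by simp))
  obtain ⟨δ, hδ, hdet⟩ := exists_det_one_add_pos (E := E)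
  -- Below `δ` the determinant stays positive; below `1` the perturbation is a contraction, so the
  -- perturbed identity is injective.
  obtain ⟨t₀, ht₀, ht₀1, hKδ⟩ : ∃ t₀ : ℝ, 0 < t₀ ∧ t₀ < 1 ∧ t₀ * K < min δ 1 := by
    refine ⟨min δ 1 / (2 * (K + min δ 1)), by positivity, ?_, ?_⟩
    · have : 0 < min δ 1 := by positivity
      rw [div_lt_one (by positivity)]; linarith
    · have : 0 < min δ 1 := by positivity
      rw [div_mul_eq_mul_div, div_lt_iff₀ (by positivity)]
      nlinarith
  have hgd : ∀ t : ℝ, ∀ x ∈ closedBall (0 : E) 1,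
      HasFDerivAt (fun x => x + t • (f x - x)) (1 + t • G x) x := by
    intro t x hx
    have h1 := ((hd x hx).differentiableAt one_ne_zero).hasFDerivAt
    exact (hasFDerivAt_id x).add ((h1.sub (hasFDerivAt_id x)).const_smul t)
  have hsmall : ∀ t ∈ Set.Ioc 0 t₀, ∀ x ∈ closedBall (0 : E) 1,
      ‖t • G x‖ < min δ 1 := by
    intro t ht x hx
    rw [norm_smul, Real.norm_of_nonneg ht.1.le]
    exact (mul_le_mul ht.2 (hK x hx) (norm_nonneg _) ht₀.le).trans_lt hKδ
  have hvol : ∀ t ∈ Set.Ioc 0 t₀,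
      ∫ x in closedBall (0 : E) 1, (1 + t • G x).det = volume.real (closedBall (0 : E) 1) := by
    intro t ht
    have hinj : Set.InjOn (fun x => x + t • (f x - x)) (closedBall 0 1) := by
      intro x hx y hy hxy
      have hlip : ‖(f y - y) - (f x - x)‖ ≤ K * ‖y - x‖ :=
        (convex_closedBall (0 : E) 1).norm_image_sub_le_of_norm_hasFDerivWithin_le
          (f := fun x => f x - x) (f' := G)
          (fun z hz => ((((hd z hz).differentiableAt one_ne_zero).hasFDerivAt).sub
            (hasFDerivAt_id z)).hasFDerivWithinAt) hK hx hy
      have he : x - y = t • ((f y - y) - (f x - x)) := by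
        have : x + t • (f x - x) = y + t • (f y - y) := hxy
        rw [smul_sub, sub_eq_sub_iff_add_eq_add, this, add_comm]
      have hn : ‖x - y‖ ≤ t * K * ‖x - y‖ := by
        calc ‖x - y‖ = t * ‖(f y - y) - (f x - x)‖ := by
              conv_lhs => rw [he]
              rw [norm_smul, Real.norm_of_nonneg ht.1.le]
          _ ≤ t * (K * ‖y - x‖) := by gcongr; exact ht.1.le
          _ = t * K * ‖x - y‖ := by rw [norm_sub_rev]; ring
      have htK : t * K < 1 :=
        (mul_le_mul_of_nonneg_right ht.2 hK0).trans_lt (hKδ.trans_le (min_le_right _ _))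
      have : ‖x - y‖ ≤ 0 := by nlinarith [norm_nonneg (x - y)]
      exact sub_eq_zero.1 (norm_le_zero_iff.1 this)
    have himg : (fun x => x + t • (f x - x)) '' closedBall 0 1 = closedBall 0 1 := by
      apply image_closedBall_eq
      · intro x hx
        exact contDiffAt_id.add (((hd x hx).sub contDiffAt_id).const_smul t)
      · intro x hx
        rw [(hgd t x hx).fderiv]
        exact (hdet _ ((hsmall t ht x hx).trans_le (min_le_left _ _))).ne'
      · intro x hx
        simp [hid x hx]
      · intro x hx
        have h1 : ‖x‖ < 1 := by simpa using hx
        have h2 := hf x (ball_subset_closedBall hx)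
        have h3 : x + t • (f x - x) = (1 - t) • x + t • f x := by module
        have ht1 : t < 1 := ht.2.trans_lt ht₀1
        rw [mem_ball_zero_iff, h3]
        refine (norm_add_le _ _).trans_lt ?_
        rw [norm_smul, norm_smul, Real.norm_of_nonneg ht.1.le,
          Real.norm_of_nonneg (by linarith), h2]
        nlinarith
    have h := integral_image_eq_integral_abs_det_fderiv_smul volume
      (isClosed_closedBall.measurableSet) (fun x hx => (hgd t x hx).hasFDerivWithinAt) hinj
      (fun _ => (1 : ℝ))
    rw [himg] at h
    simp only [smul_eq_mul, mul_one, integral_const, MeasurableSet.univ, measureReal_restrict_apply,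
      Set.univ_inter] at h
    rw [h]
    refine setIntegral_congr_fun isClosed_closedBall.measurableSet fun x hx => ?_
    exact (abs_of_pos (hdet _ ((hsmall t ht x hx).trans_le (min_le_left _ _)))).symm
  have hzero : ∀ x ∈ closedBall (0 : E) 1, (1 + G x).det = 0 := by
    have hG1 : ∀ x, 1 + G x = fderiv ℝ f x := fun x => by simp [hG]
    simp only [hG1]
    -- Differentiating `‖f‖² = 1` shows that the range of `f'` is orthogonal to `f x`, so `f'` is
    -- not surjective.
    have hin : Set.EqOn (fun x => (fderiv ℝ f x).det) (fun _ => 0) (ball (0 : E) 1) := by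
      intro x hx
      have hx' := ball_subset_closedBall hx
      by_contra hne
      obtain ⟨v, hv⟩ := surjective_of_det_ne_zero hne (f x)
      have h1 := ((hd x hx').differentiableAt one_ne_zero).hasFDerivAt
      have h2 : HasFDerivAt (fun y => ‖f y‖ ^ 2) (0 : E →L[ℝ] ℝ) x := by
        refine (hasFDerivAt_const (1 : ℝ) x).congr_of_eventuallyEq ?_
        filter_upwards [isOpen_ball.mem_nhds hx] with y hy
        rw [hf y (ball_subset_closedBall hy), one_pow]
      have h3 := congrArg (fun L : E →L[ℝ] ℝ => L v) (h1.norm_sq.unique h2)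
      simp [hv, hf x hx'] at h3
    have := hin.of_subset_closure
      (ContinuousLinearMap.continuous_det.comp_continuousOn hfd) continuousOn_const
      ball_subset_closedBall (by rw [closure_ball _ one_ne_zero])
    exact fun x hx => this hx
  let s : Fin (Module.finrank ℝ E + 1) → ℝ := fun k => t₀ / (k + 1)
  have hs : Function.Injective s := by
    intro a b hab
    have h1 : (a : ℝ) + 1 = b + 1 := by
      have : t₀ / ((a : ℝ) + 1) = t₀ / (b + 1) := hab
      rw [div_eq_div_iff (by positivity) (by positivity)] at this
      exact (mul_left_cancel₀ ht₀.ne' this).symm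
    exact Fin.ext (by exact_mod_cast add_right_cancel h1)
  have hsmem : ∀ k, s k ∈ Set.Ioc 0 t₀ := fun k =>
    ⟨by positivity, div_le_self ht₀.le (by linarith [(k : ℕ).cast_nonneg (α := ℝ)])⟩
  have hint : ∀ t : ℝ, IntegrableOn (fun x => (1 + t • G x).det) (closedBall (0 : E) 1) := by
    intro t
    apply ContinuousOn.integrableOn_compact (isCompact_closedBall _ _)
    exact ContinuousLinearMap.continuous_det.comp_continuousOn
      (continuousOn_const.add (hGc.const_smul t))
  have hfin : (0 : ℝ) = volume.real (closedBall (0 : E) 1) := by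
    calc (0 : ℝ) = ∫ x in closedBall (0 : E) 1, (1 + G x).det := by
          rw [setIntegral_congr_fun isClosed_closedBall.measurableSet hzero]; simp
      _ = ∫ x in closedBall (0 : E) 1,
            ∑ k, (Lagrange.basis univ s k).eval 1 * (1 + s k • G x).det := by
          simp_rw [← det_one_add_eq_sum s hs]
      _ = ∑ k, (Lagrange.basis univ s k).eval 1 * volume.real (closedBall (0 : E) 1) := by
          rw [integral_finsetSum _ fun k _ => (hint (s k)).const_mul _]
          refine sum_congr rfl fun k _ => ?_
          rw [integral_const_mul, hvol _ (hsmem k)]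
      _ = volume.real (closedBall (0 : E) 1) := by
          rw [← sum_mul, sum_eval_basis_one s hs, one_mul]
  have hpos : 0 < volume.real (closedBall (0 : E) 1) :=
    ENNReal.toReal_pos (measure_closedBall_pos _ _ one_pos).ne'
      (isCompact_closedBall _ _).measure_ne_top
  exact hpos.ne hfin

theorem exists_fixedPoint_of_norm_lt_one {F : E → E} (hF : ContDiff ℝ 1 F)
    (hb : ∀ x, ‖F x‖ < 1) : ∃ x, F x = x := by
  by_contra! hne
  set w : E → E := fun x => x - F x with hw
  have hwd : ContDiff ℝ 1 w := contDiff_id.sub hF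
  have hw0 : ∀ x, 0 < ‖w x‖ ^ 2 := fun x => by
    have : w x ≠ 0 := sub_ne_zero.2 (hne x).symm
    positivity
  -- The retraction follows the ray from `F x` through `x` to the sphere. `D` is the reduced
  -- discriminant of `‖x + c w‖² = 1` as a quadratic in `c`; its positivity on the closed ball makes
  -- the larger root `c` a `C^1` function there.
  set D : E → ℝ := fun x => inner ℝ x (w x) ^ 2 + ‖w x‖ ^ 2 * (1 - ‖x‖ ^ 2) with hD
  have hxw : ∀ x, ‖x‖ = 1 → 0 < inner ℝ x (w x) := by
    intro x hx
    have h1 : inner ℝ x (w x) = 1 - inner ℝ x (F x) := by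
      rw [hw, inner_sub_right, real_inner_self_eq_norm_sq, hx, one_pow]
    have h2 := real_inner_le_norm x (F x)
    rw [hx, one_mul] at h2
    rw [h1]
    linarith [hb x]
  have hD0 : ∀ x ∈ closedBall (0 : E) 1, 0 < D x := by
    intro x hx
    rw [mem_closedBall_zero_iff] at hx
    rcases hx.lt_or_eq with h | h
    · have : 0 < 1 - ‖x‖ ^ 2 := by nlinarith [norm_nonneg x]
      have := mul_pos (hw0 x) this
      positivity
    · have := hxw x h
      simp only [hD, h]
      positivity
  set c : E → ℝ := fun x => (-inner ℝ x (w x) + √(D x)) / ‖w x‖ ^ 2 with hc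
  have hDd : ContDiff ℝ 1 D :=
    ((contDiff_id.inner ℝ hwd).pow 2).add
      ((hwd.norm_sq ℝ).mul (contDiff_const.sub (contDiff_id.norm_sq ℝ)))
  refine no_retraction (E := E) (f := fun x => x + c x • w x) ?_ ?_ ?_
  · intro x hx
    have h1 : ContDiffAt ℝ 1 c x :=
      (((contDiff_id.inner ℝ hwd).neg.contDiffAt).add
        (hDd.contDiffAt.sqrt (hD0 x hx).ne')).div (hwd.norm_sq ℝ).contDiffAt (hw0 x).ne'
    exact contDiffAt_id.add (h1.smul hwd.contDiffAt)
  · intro x hx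
    rw [mem_sphere_zero_iff_norm] at hx
    have : c x = 0 := by
      simp [hc, hD, hx, Real.sqrt_sq (hxw x hx).le]
    simp [this]
  · intro x hx
    have hsq : ‖x + c x • w x‖ ^ 2 = 1 := by
      have hcw : c x * ‖w x‖ ^ 2 = -inner ℝ x (w x) + √(D x) := div_mul_cancel₀ _ (hw0 x).ne'
      have hs := Real.sq_sqrt (hD0 x hx).le
      rw [norm_add_sq_real, norm_smul, inner_smul_right, mul_pow, Real.norm_eq_abs, sq_abs]
      apply mul_right_cancel₀ (hw0 x).ne'
      have hDx : D x = inner ℝ x (w x) ^ 2 + ‖w x‖ ^ 2 * (1 - ‖x‖ ^ 2) := rfl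
      linear_combination (c x * ‖w x‖ ^ 2 + inner ℝ x (w x) + √(D x)) * hcw + hs + hDx
    exact (pow_eq_one_iff_of_nonneg (norm_nonneg _) two_ne_zero).1 hsq

/-- **Brouwer's fixed point theorem** for bounded `C^1` maps. -/
theorem exists_fixedPoint_of_bounded {F : E → E} (hF : ContDiff ℝ 1 F) {R : ℝ}
    (hb : ∀ x, ‖F x‖ < R) : ∃ x, F x = x := by
  have hR : 0 < R := (norm_nonneg _).trans_lt (hb 0)
  obtain ⟨x, hx⟩ := exists_fixedPoint_of_norm_lt_one (F := fun x => R⁻¹ • F (R • x))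
    ((hF.comp (contDiff_id.const_smul R)).const_smul R⁻¹) (fun x => by
      rw [norm_smul, norm_inv, Real.norm_of_nonneg hR.le, inv_mul_lt_one₀ hR]
      exact hb _)
  refine ⟨R • x, ?_⟩
  conv_rhs => rw [← hx]
  rw [smul_inv_smul₀ hR.ne']

end Brouwer

/-! ### Rounding to the grid, and points of trivial simplices. -/

section Estimates

/-- Every probability vector is within `1 / M` of a grid point in each coordinate. -/
theorem exists_mem_gridSimplex {α : Type*} [Fintype α] {p : α → ℝ} (hp : p ∈ stdSimplex ℝ α)
    {M : ℕ} (hM : 0 < M) : ∃ q ∈ gridSimplex M α, ∀ a, |q a - p a| ≤ 1 / M := by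
  classical
  have hM' : (0 : ℝ) < M := by exact_mod_cast hM
  set f : α → ℕ := fun a => ⌊M * p a⌋₊ with hf
  have hfl : ∀ a, (f a : ℝ) ≤ M * p a := fun a => Nat.floor_le (mul_nonneg hM'.le (hp.1 a))
  have hlf : ∀ a, M * p a < f a + 1 := fun a => Nat.lt_floor_add_one _
  have hsum : ∑ a, M * p a = M := by rw [← mul_sum, hp.2, mul_one]
  have h1 : ∑ a, f a ≤ M := by
    have : ∑ a, (f a : ℝ) ≤ M := (sum_le_sum fun a _ => hfl a).trans hsum.le
    exact_mod_cast this
  have h2 : M ≤ ∑ a, f a + Fintype.card α := by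
    have : (M : ℝ) ≤ ∑ a, ((f a : ℝ) + 1) := hsum.symm.le.trans (sum_le_sum fun a _ => (hlf a).le)
    rw [sum_add_distrib] at this
    simp only [sum_const, card_univ, nsmul_eq_mul, mul_one] at this
    exact_mod_cast this
  -- Rounding down leaves a deficit between `0` and `|α|`, repaired by adding one unit at that many
  -- coordinates.
  obtain ⟨t, -, ht⟩ := exists_subset_card_eq (s := (univ : Finset α)) (n := M - ∑ a, f a)
    (by rw [card_univ]; omega)
  set k : α → ℕ := fun a => f a + if a ∈ t then 1 else 0 with hk
  have hksum : ∑ a, k a = M := by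
    have : ∑ a, (if a ∈ t then 1 else 0) = M - ∑ a, f a := by
      rw [sum_boole, filter_mem_eq_inter, univ_inter, ht, Nat.cast_id]
    rw [sum_add_distrib, this]
    omega
  have hk' : ∀ a, |(k a : ℝ) - M * p a| ≤ 1 := by
    intro a
    have := hfl a
    have := hlf a
    rw [abs_le]
    by_cases hat : a ∈ t <;> simp only [hk, hat, if_true, if_false] <;> push_cast <;>
      constructor <;> linarith
  refine ⟨fun a => k a / M, ⟨⟨fun a => by positivity, ?_⟩, fun a => ⟨k a, ?_, rfl⟩⟩, fun a => ?_⟩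
  · rw [← sum_div, ← Nat.cast_sum, hksum, div_self hM'.ne']
  · rw [← hksum]; exact single_le_sum (fun _ _ => Nat.zero_le _) (mem_univ a)
  · have : (k a : ℝ) / M - p a = (k a - M * p a) / M := by field_simp
    rw [this, abs_div, abs_of_pos hM']
    gcongr
    exact hk' a

theorem eq_of_mem_stdSimplex_of_card_le_one {α : Type*} [Fintype α] (hα : Fintype.card α ≤ 1)
    {p q : α → ℝ} (hp : p ∈ stdSimplex ℝ α) (hq : q ∈ stdSimplex ℝ α) : p = q := by
  have := Fintype.card_le_one_iff_subsingleton.1 hα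
  have key : ∀ {r : α → ℝ}, r ∈ stdSimplex ℝ α → ∀ a, r a = 1 := fun {r} hr a => by
    rw [← hr.2]; exact (Fintype.sum_subsingleton _ a).symm
  ext a
  rw [key hp, key hq]

/-! ### Distances between product distributions. -/

section Product

variable {J : Type*} [Fintype J] [DecidableEq J] {B : J → Type*} [∀ j, Fintype (B j)]

/-- The difference is itself a product, with factor `p - h k` at `k`, so the sum of absolute values
factorizes and every other factor sums to one. -/
theorem sum_abs_prod_update_sub {h : (j : J) → B j → ℝ} (hh : ∀ j, h j ∈ stdSimplex ℝ (B j))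
    (k : J) (p : B k → ℝ) :
    ∑ a : (j : J) → B j, |∏ j, Function.update h k p j (a j) - ∏ j, h j (a j)| =
      ∑ x, |p x - h k x| := by
  have h1 : ∀ a : (j : J) → B j, ∏ j, Function.update h k p j (a j) - ∏ j, h j (a j) =
      ∏ j, Function.update h k (p - h k) j (a j) := by
    intro a
    rw [← mul_prod_erase univ _ (mem_univ k), ← mul_prod_erase univ (fun j => h j (a j)) (mem_univ k),
      ← mul_prod_erase univ (fun j => Function.update h k (p - h k) j (a j)) (mem_univ k)]
    have e : ∀ r : B k → ℝ, ∏ j ∈ univ.erase k, Function.update h k r j (a j) =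
        ∏ j ∈ univ.erase k, h j (a j) := fun r =>
      prod_congr rfl fun j hj => by rw [Function.update_of_ne (ne_of_mem_erase hj)]
    rw [e, e]
    simp only [Function.update_self, Pi.sub_apply]
    ring
  simp_rw [h1, abs_prod]
  rw [← Fintype.prod_sum fun j x => |Function.update h k (p - h k) j x|, ← mul_prod_erase univ _ (mem_univ k), prod_eq_one, mul_one]
  · simp
  · intro j hj
    rw [Function.update_of_ne (ne_of_mem_erase hj), ← (hh j).2]
    exact sum_congr rfl fun x _ => abs_of_nonneg ((hh j).1 x)

/-- The `ℓ¹` distance of product distributions is at most the sum of those of the factors. -/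
theorem sum_abs_prod_sub_prod_le {b c : (j : J) → B j → ℝ} (hb : ∀ j, b j ∈ stdSimplex ℝ (B j))
    (hc : ∀ j, c j ∈ stdSimplex ℝ (B j)) :
    ∑ a : (j : J) → B j, |∏ j, b j (a j) - ∏ j, c j (a j)| ≤ ∑ j, ∑ x, |b j x - c j x| := by
  have key : ∀ s : Finset J, ∑ a : (j : J) → B j, |∏ j, s.piecewise b c j (a j) - ∏ j, c j (a j)|
      ≤ ∑ j ∈ s, ∑ x, |b j x - c j x| := by
    intro s
    induction s using Finset.induction_on with
    | empty => simp
    | insert k s hk ih =>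
      rw [sum_insert hk, piecewise_insert]
      have hm : ∀ j, s.piecewise b c j ∈ stdSimplex ℝ (B j) := fun j => by
        by_cases hj : j ∈ s
        · rw [piecewise_eq_of_mem _ _ _ hj]; exact hb j
        · rw [piecewise_eq_of_notMem _ _ _ hj]; exact hc j
      have h1 := sum_abs_prod_update_sub hm k (b k)
      rw [piecewise_eq_of_notMem _ _ _ hk] at h1
      rw [← h1]
      refine le_trans ?_ (add_le_add le_rfl ih)
      rw [← sum_add_distrib]
      exact sum_le_sum fun a _ => abs_sub_le _ _ _
  simpa using key univ

theorem sum_two_mul_pred_le (f : J → ℝ) (hf : ∀ j, 1 ≤ f j) :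
    ∑ j, 2 * (f j - 1) ≤ 2 * (∏ j, f j - 1) := by
  have key : ∀ s : Finset J, 1 ≤ ∏ j ∈ s, f j ∧
      ∑ j ∈ s, 2 * (f j - 1) ≤ 2 * (∏ j ∈ s, f j - 1) := by
    intro s
    induction s using Finset.induction_on with
    | empty => simp
    | insert k s hk ih =>
      rw [sum_insert hk, prod_insert hk]
      obtain ⟨h1, h2⟩ := ih
      constructor <;> nlinarith [hf k, mul_nonneg (sub_nonneg.2 (hf k)) (sub_nonneg.2 h1)]
  exact (key univ).2

/-- Cauchy–Schwarz in each factor, then across factors. A singleton factor contributes nothing and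
otherwise `|B_j| ≤ 2(|B_j| - 1)`; these terms add up to at most `2(∏ |B_j| - 1)`. -/
theorem sum_abs_sub_le_sqrt_mul_sqrt [∀ j, Nonempty (B j)] {b c : (j : J) → B j → ℝ}
    (hb : ∀ j, b j ∈ stdSimplex ℝ (B j)) (hc : ∀ j, c j ∈ stdSimplex ℝ (B j)) :
    ∑ j, ∑ x, |b j x - c j x| ≤
      √(2 * ((Fintype.card ((j : J) → B j) : ℝ) - 1)) * √(∑ j, ∑ x, (b j x - c j x) ^ 2) := by
  have hcard : ∀ j, (1 : ℝ) ≤ Fintype.card (B j) := fun j => by exact_mod_cast Fintype.card_pos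
  have h1 : ∀ j, ∑ x, |b j x - c j x| ≤
      √(2 * ((Fintype.card (B j) : ℝ) - 1)) * √(∑ x, (b j x - c j x) ^ 2) := by
    intro j
    rcases le_or_gt (Fintype.card (B j)) 1 with h | h
    · simp [eq_of_mem_stdSimplex_of_card_le_one h (hb j) (hc j)]
    · have h' : (2 : ℝ) ≤ Fintype.card (B j) := by exact_mod_cast h
      rw [← Real.sqrt_mul (by linarith)]
      apply Real.le_sqrt_of_sq_le
      have := sq_sum_le_card_mul_sum_sq (s := univ) (f := fun x => |b j x - c j x|)
      simp only [sq_abs, card_univ] at this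
      refine this.trans ?_
      gcongr
      linarith
  refine (sum_le_sum fun j _ => h1 j).trans ?_
  refine (Real.sum_sqrt_mul_sqrt_le _ (fun j => by linarith [hcard j])
    (fun j => sum_nonneg fun x _ => sq_nonneg _)).trans ?_
  gcongr
  rw [Fintype.card_pi, Nat.cast_prod]
  exact sum_two_mul_pred_le _ hcard

end Product

/-! ### Stability and near-optimality of softmax. -/

section Softmax

variable {α : Type*} [Fintype α] [Nonempty α]

theorem sum_exp_pos (x : α → ℝ) : 0 < ∑ a, Real.exp (x a) :=
  sum_pos (fun _ _ => Real.exp_pos _) univ_nonempty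

theorem softmax_mem_stdSimplex (x : α → ℝ) :
    (fun a => Real.exp (x a) / ∑ a', Real.exp (x a')) ∈ stdSimplex ℝ α :=
  ⟨fun a => (div_pos (Real.exp_pos _) (sum_exp_pos x)).le, by
    rw [← sum_div, div_self (sum_exp_pos x).ne']⟩

/-- Numerator and denominator each change by a factor at most `e^δ`, so `q ≥ e^{-2δ} p ≥ (1 - 2δ)
p`, and `p ≤ 1`. -/
theorem softmax_sub_le {x y : α → ℝ} {δ : ℝ} (h : ∀ a, |x a - y a| ≤ δ) (a : α) :
    Real.exp (x a) / ∑ a', Real.exp (x a') - Real.exp (y a) / ∑ a', Real.exp (y a') ≤ 2 * δ := by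
  have hX := sum_exp_pos x
  have hY := sum_exp_pos y
  have hδ : 0 ≤ δ := (abs_nonneg _).trans (h a)
  set p := Real.exp (x a) / ∑ a', Real.exp (x a') with hp
  set q := Real.exp (y a) / ∑ a', Real.exp (y a') with hq
  have hp1 : p ≤ 1 := by
    rw [hp, div_le_one hX]
    exact single_le_sum (f := fun a => Real.exp (x a)) (fun _ _ => (Real.exp_pos _).le) (mem_univ a)
  have hp0 : 0 ≤ p := by positivity
  have h1 : Real.exp (-δ) * Real.exp (x a) ≤ Real.exp (y a) := by
    rw [← Real.exp_add]
    exact Real.exp_le_exp.2 (by linarith [(abs_le.1 (h a)).2])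
  have h2 : Real.exp (-δ) * ∑ a', Real.exp (y a') ≤ ∑ a', Real.exp (x a') := by
    rw [mul_sum]
    refine sum_le_sum fun a' _ => ?_
    rw [← Real.exp_add]
    exact Real.exp_le_exp.2 (by linarith [(abs_le.1 (h a')).1])
  have h3 : Real.exp (-(2 * δ)) * p ≤ q := by
    rw [hp, hq, ← mul_div_assoc, div_le_div_iff₀ hX hY]
    have e : Real.exp (-(2 * δ)) = Real.exp (-δ) * Real.exp (-δ) := by
      rw [← Real.exp_add]; ring_nf
    rw [e]
    calc Real.exp (-δ) * Real.exp (-δ) * Real.exp (x a) * ∑ a', Real.exp (y a')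
        = (Real.exp (-δ) * Real.exp (x a)) * (Real.exp (-δ) * ∑ a', Real.exp (y a')) := by ring
      _ ≤ _ := by gcongr
  have h4 : 1 - 2 * δ ≤ Real.exp (-(2 * δ)) := by linarith [Real.add_one_le_exp (-(2 * δ))]
  nlinarith [mul_le_mul_of_nonneg_right h4 hp0]

theorem abs_softmax_sub_le {x y : α → ℝ} {δ : ℝ} (h : ∀ a, |x a - y a| ≤ δ) (a : α) :
    |Real.exp (x a) / ∑ a', Real.exp (x a') - Real.exp (y a) / ∑ a', Real.exp (y a')| ≤ 2 * δ :=
  abs_sub_le_iff.2 ⟨softmax_sub_le h a, softmax_sub_le (fun a => by rw [abs_sub_comm]; exact h a) a⟩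

/-- The logit response loses at most the entropy bound `log |α|` against any mixed response. -/
theorem sum_mul_le_softmax_add_log (x : α → ℝ) {p : α → ℝ} (hp : p ∈ stdSimplex ℝ α) :
    ∑ a, p a * x a ≤
      ∑ a, Real.exp (x a) / (∑ a', Real.exp (x a')) * x a + Real.log (Fintype.card α) := by
  have hZ := sum_exp_pos x
  set Z := ∑ a', Real.exp (x a') with hZdef
  have hn : (0 : ℝ) < Fintype.card α := by exact_mod_cast Fintype.card_pos
  have h1 : ∑ a, p a * x a ≤ Real.log Z := by
    calc ∑ a, p a * x a ≤ ∑ a, p a * Real.log Z := by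
          refine sum_le_sum fun a _ => mul_le_mul_of_nonneg_left ?_ (hp.1 a)
          rw [Real.le_log_iff_exp_le hZ]
          exact single_le_sum (f := fun a => Real.exp (x a)) (fun _ _ => (Real.exp_pos _).le)
            (mem_univ a)
      _ = Real.log Z := by rw [← sum_mul, hp.2, one_mul]
  have hs := (softmax_mem_stdSimplex x).2
  simp only [← hZdef] at hs
  -- Gibbs' inequality termwise, from `log t ≤ t - 1`: the right-hand sides sum to zero, which
  -- bounds the entropy of softmax by `log |α|`.
  have h2 : ∀ a, Real.exp (x a) / Z * (Real.log Z - Real.log (Fintype.card α)) -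
      Real.exp (x a) / Z * x a ≤ 1 / Fintype.card α - Real.exp (x a) / Z := by
    intro a
    have hpos : 0 < Z / (Fintype.card α * Real.exp (x a)) := by positivity
    have h := Real.log_le_sub_one_of_pos hpos
    rw [Real.log_div hZ.ne' (by positivity), Real.log_mul hn.ne' (Real.exp_pos _).ne',
      Real.log_exp] at h
    have h' := mul_le_mul_of_nonneg_left h (div_pos (Real.exp_pos (x a)) hZ).le
    have e : Real.exp (x a) / Z * (Z / (Fintype.card α * Real.exp (x a)) - 1) =
        1 / Fintype.card α - Real.exp (x a) / Z := by
      field_simp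
    rw [e] at h'
    linarith
  have h3 := sum_le_sum fun (a : α) (_ : a ∈ univ) => h2 a
  rw [sum_sub_distrib, sum_sub_distrib, ← sum_mul, hs, one_mul, sum_const, card_univ,
    nsmul_eq_mul, mul_one_div_cancel hn.ne'] at h3
  linarith

end Softmax

end Estimates

/-! ### Logit equilibria and the cost of wrong beliefs. -/

section Game

variable {I : Type*} [Fintype I] [DecidableEq I] {A : I → Type*} [∀ i, Fintype (A i)]
  [∀ i, Nonempty (A i)]

theorem smoothBR_mem_stdSimplex (u : I → ((i : I) → A i) → ℝ) (σ : ℝ) (i : I) (b : OppVec A i) :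
    smoothBR u σ i b ∈ stdSimplex ℝ (A i) :=
  softmax_mem_stdSimplex _

/-- Existence of a logit (quantal response) equilibrium. -/
theorem exists_logit_equilibrium (u : I → ((i : I) → A i) → ℝ) (σ : ℝ) :
    ∃ π : (i : I) → A i → ℝ, ∀ i, π i = smoothBR u σ i (opp π i) := by
  let E := EuclideanSpace ℝ (Σ i, A i)
  let π : E → (i : I) → A i → ℝ := fun x i a => x ⟨i, a⟩
  -- The logit map makes sense for all real vectors and always lands in the simplices. It is
  -- therefore a bounded smooth map of the whole space, and no projection is needed.
  let F : E → E := fun x => WithLp.toLp 2 fun p => smoothBR u σ p.1 (opp (π x) p.1) p.2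
  have hF : ContDiff ℝ 1 F := by
    rw [contDiff_euclidean]
    rintro ⟨i, a⟩
    have hU : ∀ a', ContDiff ℝ 1 fun x : E =>
        Real.exp ((1 / σ) * beliefUtility u i a' (opp (π x) i)) := by
      intro a'
      have hp : ∀ p : Σ i, A i, ContDiff ℝ 1 fun x : E => x p :=
        contDiff_euclidean.1 contDiff_id
      refine ContDiff.exp (contDiff_const.mul (ContDiff.sum fun a'' _ => ?_))
      exact contDiff_const.mul (contDiff_prod fun j _ => hp ⟨j, a'' j⟩)
    exact (hU a).div (ContDiff.sum fun a' _ => hU a') fun x => (sum_exp_pos _).ne'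
  have hb : ∀ x, ‖F x‖ < Fintype.card (Σ i, A i) + 1 := by
    intro x
    have h1 : ‖F x‖ ^ 2 ≤ Fintype.card (Σ i, A i) := by
      rw [EuclideanSpace.real_norm_sq_eq]
      calc ∑ p, F x p ^ 2 ≤ ∑ p : (Σ i, A i), (1 : ℝ) := by
            refine sum_le_sum fun p _ => ?_
            have h := smoothBR_mem_stdSimplex u σ p.1 (opp (π x) p.1)
            exact pow_le_one₀ (h.1 _) (mem_Icc_of_mem_stdSimplex h _).2
        _ = _ := by simp
    have h0 : (0 : ℝ) ≤ Fintype.card (Σ i, A i) := Nat.cast_nonneg _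
    exact lt_of_pow_lt_pow_left₀ 2 (by positivity) (by nlinarith)
  obtain ⟨x, hx⟩ := exists_fixedPoint_of_bounded hF hb
  refine ⟨π x, fun i => funext fun a => ?_⟩
  conv_lhs => rw [← hx]

theorem abs_beliefUtility_sub_le {u : I → ((i : I) → A i) → ℝ} {C : ℝ} (hu : ∀ i a, |u i a| ≤ C)
    (i : I) (ai : A i) {b c : OppVec A i} (hb : ∀ j : {j : I // j ≠ i}, b j ∈ stdSimplex ℝ (A j))
    (hc : ∀ j : {j : I // j ≠ i}, c j ∈ stdSimplex ℝ (A j)) :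
    |beliefUtility u i ai b - beliefUtility u i ai c| ≤ C * ∑ j, ∑ x, |b j x - c j x| := by
  have hC : 0 ≤ C := (abs_nonneg _).trans (hu i (fun _ => Classical.arbitrary _))
  rw [beliefUtility, beliefUtility, ← sum_sub_distrib]
  refine (abs_sum_le_sum_abs _ _).trans ?_
  refine le_trans ?_ (mul_le_mul_of_nonneg_left (sum_abs_prod_sub_prod_le hb hc) hC)
  rw [mul_sum]
  refine sum_le_sum fun a _ => ?_
  rw [← mul_sub, abs_mul]
  exact mul_le_mul_of_nonneg_right (hu _ _) (abs_nonneg _)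

omit [∀ i, Nonempty (A i)] in
theorem utility_eq_sum_beliefUtility (u : I → ((i : I) → A i) → ℝ) (i : I)
    (π : (i : I) → A i → ℝ) :
    utility u i π = ∑ a, π i a * beliefUtility u i a (opp π i) := by
  rw [utility, ← (Equiv.piSplitAt i A).symm.sum_comp, Fintype.sum_prod_type]
  refine sum_congr rfl fun a _ => ?_
  rw [beliefUtility, mul_sum]
  refine sum_congr rfl fun a' _ => ?_
  have h1 : ∏ j, π j ((Equiv.piSplitAt i A).symm (a, a') j) = π i a * ∏ j, opp π i j (a' j) := by
    rw [Fintype.prod_eq_mul_prod_subtype_ne _ i]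
    congr 1
    · simp
    · refine Fintype.prod_congr _ _ fun j => ?_
      simp [opp, j.2]
  rw [h1]
  ring

omit [∀ i, Nonempty (A i)] in
theorem abs_utility_le {u : I → ((i : I) → A i) → ℝ} {C : ℝ} (hu : ∀ i a, |u i a| ≤ C)
    (i : I) {π : (i : I) → A i → ℝ} (hπ : ∀ i, π i ∈ stdSimplex ℝ (A i)) :
    |utility u i π| ≤ C := by
  have h1 : ∑ a : (j : I) → A j, ∏ j, π j (a j) = 1 := by
    rw [← Fintype.prod_sum]
    exact prod_eq_one fun j _ => (hπ j).2
  calc |utility u i π| ≤ ∑ a : (j : I) → A j, |(∏ j, π j (a j)) * u i a| :=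
        abs_sum_le_sum_abs _ _
    _ ≤ ∑ a : (j : I) → A j, (∏ j, π j (a j)) * C := by
        refine sum_le_sum fun a _ => ?_
        have h0 : 0 ≤ ∏ j, π j (a j) := prod_nonneg fun j _ => (hπ j).1 _
        rw [abs_mul, abs_of_nonneg h0]
        exact mul_le_mul_of_nonneg_left (hu _ _) h0
    _ = C := by rw [← sum_mul, h1, one_mul]

omit [Fintype I] [∀ i, Fintype (A i)] [∀ i, Nonempty (A i)] in
theorem opp_update (π : (i : I) → A i → ℝ) (i : I) (p : A i → ℝ) :
    opp (Function.update π i p) i = opp π i := by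
  funext j
  exact Function.update_of_ne j.2 _ _

/-- Logit responses to beliefs at `ℓ¹` distance `L` from the truth are approximate best
responses. -/
theorem utility_update_le {u : I → ((i : I) → A i) → ℝ} {C : ℝ} (hu : ∀ i a, |u i a| ≤ C)
    {σ : ℝ} (hσ : 0 < σ) (i : I) {π : (i : I) → A i → ℝ} (hπ : ∀ i, π i ∈ stdSimplex ℝ (A i))
    {b : OppVec A i} (hb : ∀ j : {j : I // j ≠ i}, b j ∈ stdSimplex ℝ (A j)) (hπb : π i = smoothBR u σ i b)
    {p : A i → ℝ} (hp : p ∈ stdSimplex ℝ (A i)) :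
    utility u i (Function.update π i p) ≤ utility u i π + σ * Real.log (Fintype.card (A i)) +
      2 * (C * ∑ j, ∑ x, |b j x - opp π i j x|) := by
  set D := C * ∑ j, ∑ x, |b j x - opp π i j x| with hD
  have hV : ∀ a, |beliefUtility u i a b - beliefUtility u i a (opp π i)| ≤ D := fun a =>
    abs_beliefUtility_sub_le hu i a hb fun j => hπ j
  rw [utility_eq_sum_beliefUtility, utility_eq_sum_beliefUtility, opp_update, Function.update_self]
  have hsoft := sum_mul_le_softmax_add_log (fun a => (1 / σ) * beliefUtility u i a b) hp
  have h1 : ∑ a, p a * beliefUtility u i a b ≤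
      ∑ a, π i a * beliefUtility u i a b + σ * Real.log (Fintype.card (A i)) := by
    have := mul_le_mul_of_nonneg_left hsoft hσ.le
    rw [mul_add, mul_sum, mul_sum] at this
    have e : ∀ q : A i → ℝ, ∑ a, σ * (q a * (1 / σ * beliefUtility u i a b)) =
        ∑ a, q a * beliefUtility u i a b := fun q =>
      sum_congr rfl fun a _ => by field_simp
    rw [e, e (fun a => _)] at this
    rw [hπb]
    exact this
  -- Used twice, for the deviation `p` and for `π i`; hence the factor `2` in the conclusion.
  have h2 : ∀ q ∈ stdSimplex ℝ (A i),
      |∑ a, q a * beliefUtility u i a b - ∑ a, q a * beliefUtility u i a (opp π i)| ≤ D := by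
    intro q hq
    rw [← sum_sub_distrib]
    refine (abs_sum_le_sum_abs _ _).trans ?_
    calc _ ≤ ∑ a, q a * D := by
          refine sum_le_sum fun a _ => ?_
          rw [← mul_sub, abs_mul, abs_of_nonneg (hq.1 a)]
          exact mul_le_mul_of_nonneg_left (hV a) (hq.1 a)
      _ = D := by rw [← sum_mul, hq.2, one_mul]
  have h3 := (abs_le.1 (h2 p hp)).1
  have h4 := (abs_le.1 (h2 (π i) (hπ i))).2
  linarith

/-! ### The two halves of the theorem under the parameter conditions. -/

section Bounds

variable [Nonempty I]

theorem abs_le_maxPayoff (u : I → ((i : I) → A i) → ℝ) (i : I) (a : (i : I) → A i) :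
    |u i a| ≤ maxPayoff u :=
  le_sup' (fun p : I × ((i : I) → A i) => |u p.1 p.2|) (mem_univ (i, a))

omit [DecidableEq I] [∀ i, Nonempty (A i)] in
theorem card_le_maxActions (i : I) : Fintype.card (A i) ≤ maxActions A :=
  le_sup' (fun i => Fintype.card (A i)) (mem_univ i)

omit [∀ i, Nonempty (A i)] in
theorem card_pi_le_maxProd : Fintype.card ((j : I) → A j) ≤ maxProd A := by
  obtain ⟨i⟩ := ‹Nonempty I›
  rw [Fintype.card_congr (Equiv.piSplitAt i A), Fintype.card_prod]
  exact le_sup' (fun i : I => Fintype.card (A i) * Fintype.card ((j : {j : I // j ≠ i}) → A j))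
    (mem_univ i)

theorem card_le_maxProd (i : I) : Fintype.card (A i) ≤ maxProd A := by
  refine le_trans ?_ card_pi_le_maxProd
  rw [Fintype.card_congr (Equiv.piSplitAt i A), Fintype.card_prod]
  exact Nat.le_mul_of_pos_right _ Fintype.card_pos

theorem isEpsNash_of_mem_consistentStates {u : I → ((i : I) → A i) → ℝ} {ε σ τ : ℝ} {M : ℕ}
    (hε : 0 < ε) (hσ : 0 < σ) (hτ : 0 < τ) (h : ParamCond u ε σ τ M)
    {z : ((i : I) → OppVec A i) × ((i : I) → A i → ℝ)} (hz : z ∈ consistentStates u σ τ M) :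
    IsEpsNash u ε z.2 := by
  obtain ⟨b, π⟩ := z
  obtain ⟨hst, hdist⟩ := hz
  have hbr : ∀ i, π i = smoothBR u σ i (b i) := fun i => (hst i).2
  have hπ : ∀ i, π i ∈ stdSimplex ℝ (A i) := fun i =>
    hbr i ▸ smoothBR_mem_stdSimplex u σ i (b i)
  refine ⟨hπ, fun i p hp => ?_⟩
  change utility u i π ≥ utility u i (Function.update π i p) - ε
  have hup : ∀ j, Function.update π i p j ∈ stdSimplex ℝ (A j) := fun j => by
    rcases eq_or_ne j i with rfl | hj
    · rwa [Function.update_self]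
    · rw [Function.update_of_ne hj]; exact hπ j
  set C := maxPayoff u with hC
  have hu : ∀ i a, |u i a| ≤ C := abs_le_maxPayoff u
  -- Payoffs vary by at most `2C`, so small `C` is trivial, as is a single action. Otherwise `2σ log
  -- 2 ≤ ε < 2C`, which bounds `σ` by a multiple of `C` and cancels one factor `C` in the condition
  -- on `τ`.
  rcases le_or_gt (2 * C) ε with hCε | hCε
  · have h1 := (abs_le.1 (abs_utility_le hu i hπ)).1
    have h2 := (abs_le.1 (abs_utility_le hu i hup)).2
    linarith
  rcases le_or_gt (Fintype.card (A i)) 1 with hcard | hcard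
  · rw [eq_of_mem_stdSimplex_of_card_le_one hcard hp (hπ i), Function.update_eq_self]
    linarith
  have hCpos : 0 < C := by linarith
  have hb : ∀ j : {j : I // j ≠ i}, b i j ∈ stdSimplex ℝ (A j) := fun j => ((hst i).1 j).1
  have hgain := utility_update_le hu hσ i hπ hb (hbr i) hp
  have hL := sum_abs_sub_le_sqrt_mul_sqrt hb (c := opp π i) fun j => hπ j
  set L := ∑ j, ∑ x, |b i j x - opp π i j x| with hLdef
  set n := Fintype.card ((j : I) → A j) with hn
  have hnP : n = Fintype.card (A i) * Fintype.card ((j : {j : I // j ≠ i}) → A j) := by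
    rw [hn, Fintype.card_congr (Equiv.piSplitAt i A), Fintype.card_prod]
  set P := Fintype.card ((j : {j : I // j ≠ i}) → A j) with hP
  have hP1 : (1 : ℝ) ≤ P := by exact_mod_cast Fintype.card_pos
  have hnP' : 2 * (P : ℝ) ≤ n := by
    rw [hnP]; exact_mod_cast Nat.mul_le_mul_right _ hcard
  have hnN : (n : ℝ) ≤ maxProd A := by exact_mod_cast card_pi_le_maxProd
  have hσm : σ * (2 * Real.log (Fintype.card (A i))) ≤ ε := by
    refine le_trans ?_ h.sigma_le
    gcongr
    exact card_le_maxActions i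
  have hσC : σ ≤ 3 / 2 * C := by
    have hlog : 2 / 3 ≤ Real.log (Fintype.card (A i)) := by
      have : Real.log 2 ≤ Real.log (Fintype.card (A i)) :=
        Real.log_le_log two_pos (by exact_mod_cast hcard)
      linarith [Real.log_two_gt_d9]
    nlinarith
  have hLτ : L ≤ √(n - 2) * τ := by
    refine hL.trans ?_
    refine mul_le_mul (Real.sqrt_le_sqrt (by linarith)) (hdist i) (Real.sqrt_nonneg _)
      (Real.sqrt_nonneg _)
  have hτn : τ * (4 * √n * C * n) ≤ 3 * ε := by
    have h1 : τ * (2 * √n * C ^ 2 * n) ≤ ε * (3 / 2 * C) :=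
      calc τ * (2 * √n * C ^ 2 * n) ≤ τ * (2 * √n * C ^ 2 * maxProd A) := by gcongr
        _ ≤ ε * σ := h.tau_le
        _ ≤ ε * (3 / 2 * C) := by gcongr
    refine le_of_mul_le_mul_right ?_ hCpos
    nlinarith
  -- Squared, this is `9(n - 2) ≤ n³`; it absorbs the `3` left over from `σ ≤ 3C/2`.
  have hsqrt : 3 * √((n : ℝ) - 2) ≤ √n * n := by
    have hn0 : (0 : ℝ) ≤ n := by linarith
    have hn2 : (0 : ℝ) ≤ (n : ℝ) - 2 := by linarith
    refine (pow_le_pow_iff_left₀ (by positivity) (by positivity) two_ne_zero).1 ?_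
    rw [mul_pow, mul_pow, Real.sq_sqrt hn2, Real.sq_sqrt hn0]
    nlinarith [mul_nonneg hn2 (sq_nonneg ((n : ℝ) - 3)), sq_nonneg ((n : ℝ) - 3)]
  have hCL : 4 * (C * L) ≤ ε := by
    have h1 : 4 * (C * L) ≤ 4 * (C * (√((n : ℝ) - 2) * τ)) := by gcongr
    have h2 : 3 * (4 * (C * (√((n : ℝ) - 2) * τ))) ≤ τ * (4 * √n * C * n) := by
      calc 3 * (4 * (C * (√((n : ℝ) - 2) * τ))) = (4 * C * τ) * (3 * √((n : ℝ) - 2)) := by ring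
        _ ≤ (4 * C * τ) * (√n * n) := by gcongr
        _ = _ := by ring
    linarith
  linarith

omit [∀ i, Nonempty (A i)] in
theorem oppDist_le_sqrt_mul {i : I} {b c : OppVec A i} {r : ℝ} (hr : 0 ≤ r)
    (h : ∀ j x, |b j x - c j x| ≤ r) :
    oppDist i b c ≤ √(Fintype.card I * maxActions A) * r := by
  rw [oppDist]
  apply Real.sqrt_le_iff.2 ⟨by positivity, ?_⟩
  rw [mul_pow, Real.sq_sqrt (by positivity)]
  calc ∑ j, ∑ x, (b j x - c j x) ^ 2 ≤ ∑ j : {j : I // j ≠ i}, (maxActions A : ℝ) * r ^ 2 := by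
        refine sum_le_sum fun j _ => ?_
        calc ∑ x, (b j x - c j x) ^ 2 ≤ ∑ x : A j, r ^ 2 :=
              sum_le_sum fun x _ => sq_le_sq' (abs_le.1 (h j x)).1 (abs_le.1 (h j x)).2
          _ = Fintype.card (A j) * r ^ 2 := by simp
          _ ≤ _ := by gcongr; exact card_le_maxActions _
    _ = Fintype.card {j : I // j ≠ i} * (maxActions A * r ^ 2) := by simp
    _ ≤ Fintype.card I * (maxActions A * r ^ 2) := by
        gcongr
        exact_mod_cast Fintype.card_subtype_le _
    _ = _ := by ring

omit [∀ i, Nonempty (A i)] in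
theorem sum_abs_le_card_mul {i : I} {b c : OppVec A i} {r : ℝ} (hr : 0 ≤ r)
    (h : ∀ j x, |b j x - c j x| ≤ r) :
    ∑ j, ∑ x, |b j x - c j x| ≤ Fintype.card I * (maxActions A * r) := by
  calc ∑ j, ∑ x, |b j x - c j x| ≤ ∑ j : {j : I // j ≠ i}, (maxActions A : ℝ) * r := by
        refine sum_le_sum fun j _ => ?_
        calc ∑ x, |b j x - c j x| ≤ ∑ x : A j, r := sum_le_sum fun x _ => h j x
          _ = Fintype.card (A j) * r := by simp
          _ ≤ _ := by gcongr; exact card_le_maxActions _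
    _ = Fintype.card {j : I // j ≠ i} * (maxActions A * r) := by simp
    _ ≤ _ := by
        gcongr
        exact_mod_cast Fintype.card_subtype_le _

theorem consistentStates_nonempty {u : I → ((i : I) → A i) → ℝ} {ε σ τ : ℝ} {M : ℕ}
    (hσ : 0 < σ) (hτ : 0 < τ) (hM : 0 < M) (h : ParamCond u ε σ τ M) :
    (consistentStates u σ τ M).Nonempty := by
  obtain ⟨π, hπ⟩ := exists_logit_equilibrium u σ
  have hπs : ∀ i, π i ∈ stdSimplex ℝ (A i) := fun i => hπ i ▸ smoothBR_mem_stdSimplex u σ i _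
  choose q hq hqπ using fun i => exists_mem_gridSimplex (hπs i) hM
  -- Strategies must be exact responses to the grid beliefs, so `π` serves only as an intermediate
  -- point in the distance estimate.
  refine ⟨(fun i => opp q i, fun i => smoothBR u σ i (opp q i)),
    fun i => ⟨fun j => hq j, rfl⟩, fun i => ?_⟩
  dsimp only
  -- If `maxProd A ≤ 1`, all action sets are singletons and the distance is zero. Otherwise `N ≥ 2`,
  -- which absorbs the `2` of the softmax bound.
  rcases le_or_gt (maxProd A) 1 with hN | hN
  · have h1 : opp q i = opp (fun i => smoothBR u σ i (opp q i)) i := funext fun j =>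
      eq_of_mem_stdSimplex_of_card_le_one ((card_le_maxProd _).trans hN) (hq j).1
        (smoothBR_mem_stdSimplex u σ j _)
    rw [← h1]
    simpa [oppDist] using hτ.le
  have hM' : (0 : ℝ) < M := by exact_mod_cast hM
  set C := maxPayoff u with hC
  have hu : ∀ i a, |u i a| ≤ C := abs_le_maxPayoff u
  have hC0 : 0 ≤ C := (abs_nonneg _).trans (hu i fun _ => Classical.arbitrary _)
  set k : ℝ := (Fintype.card I : ℝ) with hk
  set m : ℝ := (maxActions A : ℝ) with hm
  have hk1 : 1 ≤ k := by rw [hk]; exact_mod_cast Fintype.card_pos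
  have hm1 : 1 ≤ m := by
    rw [hm]; exact_mod_cast Fintype.card_pos.trans_le (card_le_maxActions (A := A) i)
  set δ : ℝ := 1 / σ * (C * (k * (m * (1 / M)))) with hδ
  have hδ0 : 0 ≤ δ := by positivity
  have hBr : ∀ j a, |smoothBR u σ j (opp q j) a - π j a| ≤ 2 * δ := by
    intro j a
    rw [hπ j]
    refine abs_softmax_sub_le (x := fun a' => 1 / σ * beliefUtility u j a' (opp q j))
      (y := fun a' => 1 / σ * beliefUtility u j a' (opp π j)) (fun a' => ?_) a
    rw [← mul_sub, abs_mul, abs_of_pos (by positivity : 0 < 1 / σ)]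
    refine mul_le_mul_of_nonneg_left ?_ (by positivity)
    refine (abs_beliefUtility_sub_le hu j a' (fun l => (hq l).1) fun l => hπs l).trans ?_
    exact mul_le_mul_of_nonneg_left
      (sum_abs_le_card_mul (by positivity) fun l x => hqπ l x) hC0
  have hdist := oppDist_le_sqrt_mul (i := i) (b := opp q i)
    (c := opp (fun i => smoothBR u σ i (opp q i)) i) (r := 1 / M + 2 * δ) (by positivity)
    fun j x => by
      refine (abs_sub_le _ (π j x) _).trans (add_le_add (hqπ j x) ?_)
      rw [abs_sub_comm]
      exact hBr j x
  refine hdist.trans ?_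
  have hN2 : (2 : ℝ) ≤ maxProd A := by exact_mod_cast hN
  set N : ℝ := (maxProd A : ℝ) with hNdef
  have hle : k * m * (1 + √m / σ * C * N * k) ≤ τ * M := by
    have := h.le_M
    rw [div_mul_eq_mul_div, div_le_iff₀ hτ] at this
    linarith
  have hsk : √k ≤ k := Real.sqrt_le_iff.2 ⟨by positivity, by nlinarith⟩
  have hsm : √m ≤ m := Real.sqrt_le_iff.2 ⟨by positivity, by nlinarith⟩
  have h1 : √(k * m) * (1 / M + 2 * δ) * M = √k * √m * (1 + 2 * (C * k * m / σ)) := by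
    rw [Real.sqrt_mul (by positivity), hδ]
    field_simp
  refine le_of_mul_le_mul_right ?_ hM'
  rw [h1]
  refine le_trans ?_ hle
  have h2 : √k * √m ≤ k * m := mul_le_mul hsk hsm (Real.sqrt_nonneg _) (by positivity)
  have h3 : √k * √m * (2 * (C * k * m / σ)) ≤ k * m * (√m / σ * C * N * k) := by
    calc √k * √m * (2 * (C * k * m / σ)) ≤ k * √m * (N * (C * k * m / σ)) := by gcongr
      _ = _ := by field_simp
  linarith

end Bounds

end Game

end SmoothBR

theorem proposition2 {I : Type*} [Fintype I] [DecidableEq I] [Nonempty I]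
    {A : I → Type*} [∀ i, Fintype (A i)] [∀ i, Nonempty (A i)]
    (u : I → ((i : I) → A i) → ℝ) (ε σ τ : ℝ) (M : ℕ)
    (hε : 0 < ε) (hσ : 0 < σ) (hτ : 0 < τ) (hM : 0 < M)
    (h : SmoothBR.ParamCond u ε σ τ M) :
    (SmoothBR.consistentStates u σ τ M).Nonempty ∧
      ∀ z ∈ SmoothBR.consistentStates u σ τ M, SmoothBR.IsEpsNash u ε z.2 :=
  ⟨SmoothBR.consistentStates_nonempty hσ hτ hM h,
    fun _ hz => SmoothBR.isEpsNash_of_mem_consistentStates hε hσ hτ h hz⟩
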